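/- Let $n\ge 1$, let $S^{n-1}$ be the unit sphere of $\mathbb R^n$ with its round metric, let $g:S^{n-1}\to[0,\infty)$ be continuous, and extend $g$ to a function homogeneous of degree one on $\mathbb R^n$ by $U(x)=|x|\,g(x/|x|)$ for $x\neq 0$ and $U(0)=0$. Then $U$ is convex on $\mathbb R^n$ if and only if $\operatorname{Hess} g+gI\ge 0$ on $S^{n-1}$ in the viscosity sense, that is: for every $\sigma\in S^{n-1}$ and every function $\varphi$ of class $C^2$ near $\sigma$ in $S^{n-1}$ with $\varphi(\sigma)=g(\sigma)$ and $g\le\varphi$ near $\sigma$, one has $$(\operatorname{Hess}_\sigma\varphi)(v,v)+\varphi(\sigma)|v|^2\ \ge\ 0\qquad\text{for all } v\in T_\sigma S^{n-1},$$ where $\operatorname{Hess}$ is the Riemannian Hessian of the sphere. -/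

import Mathlib

open scoped Manifold Topology

namespace HomogConvex

noncomputable section

/-- The euclidean space `ℝ^{m+1}`. -/
abbrev Euc (m : ℕ) : Type := EuclideanSpace ℝ (Fin (m + 1))

/-- The unit sphere `S^m` of `ℝ^{m+1}`, with Mathlib's manifold structure. -/
abbrev Sph (m : ℕ) : Type := Metric.sphere (0 : Euc m) 1

/-- The radial projection `x / |x|` of a nonzero vector to the unit sphere. -/
def radialProj {m : ℕ} (x : Euc m) (hx : x ≠ 0) : Sph m :=
  ⟨‖x‖⁻¹ • x, by
    rw [mem_sphere_zero_iff_norm, norm_smul, norm_inv, norm_norm]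
    exact inv_mul_cancel₀ (norm_ne_zero_iff.mpr hx)⟩

open Classical in
/-- The extension of `g` that is homogeneous of degree one: `U(x) = |x| g(x/|x|)` for `x ≠ 0`,
and `U(0) = 0`. -/
def homogExt {m : ℕ} (g : Sph m → ℝ) (x : Euc m) : ℝ :=
  if hx : x = 0 then 0 else ‖x‖ * g (radialProj x hx)

/-- The tangent space `T_σ S^m`, as the hyperplane `σ^⊥` of `ℝ^{m+1}`. -/
abbrev tangentSphere {m : ℕ} (σ : Sph m) : Submodule ℝ (Euc m) := (ℝ ∙ (σ : Euc m))ᗮ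

/-- The geodesic `t ↦ cos(t|v|) σ + sin(t|v|) v/|v|` of the round sphere (the great circle,
with constant speed), which starts at `σ` with velocity `v ∈ T_σ S^m`.
It is constant for `v = 0`. -/
def geodesic {m : ℕ} (σ : Sph m) (v : tangentSphere σ) (t : ℝ) : Sph m :=
  ⟨Real.cos (t * ‖v‖) • (σ : Euc m) + (Real.sin (t * ‖v‖) / ‖v‖) • (v : Euc m), by
    have hσ : ‖(σ : Euc m)‖ = 1 := by simp
    have hort : inner ℝ (σ : Euc m) (v : Euc m) = 0 :=
      Submodule.mem_orthogonal_singleton_iff_inner_right.mp v.2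
    have hsq : ‖Real.cos (t * ‖v‖) • (σ : Euc m)
        + (Real.sin (t * ‖v‖) / ‖v‖) • (v : Euc m)‖ ^ 2 = 1 := by
      rw [norm_add_sq_real, norm_smul, norm_smul, inner_smul_left, inner_smul_right, hort, hσ,
        Submodule.coe_norm]
      simp only [Real.norm_eq_abs, mul_zero, add_zero, mul_one, mul_pow, sq_abs]
      by_cases hv : ‖(v : Euc m)‖ = 0
      · simp [hv]
      · rw [div_pow, div_mul_cancel₀ _ (pow_ne_zero 2 hv)]
        exact Real.cos_sq_add_sin_sq _
    rw [mem_sphere_zero_iff_norm]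
    exact (sq_eq_sq₀ (norm_nonneg _) zero_le_one).mp (by rw [hsq, one_pow])⟩

/-- The riemannian hessian of the round sphere, as a quadratic form on `T_σ S^m`.  For a tangent
field `V` that extends the velocity of the geodesic `γ` with `γ(0) = σ`, `γ'(0) = v` one has
`∇_V V = 0` along `γ`, so that `(Hess φ)(v, v) = V V φ - (∇_V V) φ = (φ ∘ γ)''(0)`.
It is used only for functions `φ` of class `C²` near `σ`. -/
def hess {m : ℕ} (φ : Sph m → ℝ) (σ : Sph m) (v : tangentSphere σ) : ℝ :=
  iteratedDeriv 2 (fun t : ℝ => φ (geodesic σ v t)) 0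

/-- `φ` is a (viscosity) test function for `g` at `σ`: it is of class `C²` near `σ`, it
agrees with `g` at `σ`, and `g ≤ φ` near `σ`. -/
def IsTestFunctionAt {m : ℕ} (g φ : Sph m → ℝ) (σ : Sph m) : Prop :=
  ContMDiffAt (𝓡 m) 𝓘(ℝ, ℝ) 2 φ σ ∧ φ σ = g σ ∧ ∀ᶠ y in 𝓝 σ, g y ≤ φ y

/-- `Hess g + g I ≥ 0` on `S^m` in the viscosity sense: at each point `σ` and for each test
function `φ` for `g` at `σ`, the quadratic form `Hess_σ φ + φ(σ) I` on `T_σ S^m` is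
nonnegative. -/
def HessAddIdNonnegViscosity {m : ℕ} (g : Sph m → ℝ) : Prop :=
  ∀ (σ : Sph m) (φ : Sph m → ℝ), IsTestFunctionAt g φ σ →
    ∀ v : tangentSphere σ, 0 ≤ hess φ σ v + φ σ * ‖v‖ ^ 2

end

end HomogConvex

namespace HomogConvex
open Filter

/-! If `U` is convex, compare `U` at the midpoint of two opposite points of a geodesic through `σ`
with its values there: the midpoint is `cos(t|v|) σ`, so the second difference at `0` of `φ ∘ γ -
cos(t|v|) φ(σ)` is nonnegative. Conversely, by homogeneity convexity is subadditivity. Two nonzero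
non-antipodal vectors lie in an open half-space `X > 0`, and rescaling reduces the claim to
convexity on the slice `X = 1` (`convex_slice`). If this fails on a segment, a quadratic strictly
concave along it touches `U` from above on the slice (`exists_quadratic_touching`). Made homogeneous
of degree one, it restricts to a test function violating the inequality (`exists_hess_barrier`). For
antipodal vectors `g ≥ 0` suffices. -/

/-! ### Homogeneous extension and great circles. -/

theorem homogExt_zero {m : ℕ} (g : Sph m → ℝ) : homogExt g 0 = 0 := by
  simp [homogExt]

theorem homogExt_of_ne {m : ℕ} (g : Sph m → ℝ) {x : Euc m} (hx : x ≠ 0) :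
    homogExt g x = ‖x‖ * g (radialProj x hx) := by
  simp [homogExt, hx]

theorem homogExt_smul {m : ℕ} (g : Sph m → ℝ) {c : ℝ} (hc : 0 ≤ c) (x : Euc m) :
    homogExt g (c • x) = c * homogExt g x := by
  rcases hc.eq_or_lt with rfl | hc
  · simp [homogExt_zero]
  by_cases hx : x = 0
  · simp [hx, homogExt_zero]
  have hcx : c • x ≠ 0 := smul_ne_zero hc.ne' hx
  have hproj : radialProj (c • x) hcx = radialProj x hx := by
    apply Subtype.ext
    simp only [radialProj, norm_smul, Real.norm_eq_abs, abs_of_pos hc, smul_smul]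
    congr 1
    field_simp
  rw [homogExt_of_ne g hcx, homogExt_of_ne g hx, hproj, norm_smul, Real.norm_eq_abs,
    abs_of_pos hc, mul_assoc]

theorem homogExt_coe {m : ℕ} (g : Sph m → ℝ) (σ : Sph m) : homogExt g (σ : Euc m) = g σ := by
  have hσ : ‖(σ : Euc m)‖ = 1 := by simp
  have h0 : (σ : Euc m) ≠ 0 := by
    rw [← norm_ne_zero_iff, hσ]; exact one_ne_zero
  have hproj : radialProj (σ : Euc m) h0 = σ := by
    apply Subtype.ext
    simp [radialProj]
  rw [homogExt_of_ne g h0, hproj, hσ, one_mul]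

theorem homogExt_nonneg {m : ℕ} {g : Sph m → ℝ} (hg0 : ∀ σ, 0 ≤ g σ) (x : Euc m) :
    0 ≤ homogExt g x := by
  by_cases hx : x = 0
  · simp [hx, homogExt_zero]
  · rw [homogExt_of_ne g hx]
    exact mul_nonneg (norm_nonneg _) (hg0 _)

theorem continuousAt_homogExt {m : ℕ} {g : Sph m → ℝ} (hg : Continuous g) {x : Euc m}
    (hx : x ≠ 0) : ContinuousAt (homogExt g) x := by
  have hopen : IsOpen {y : Euc m | y ≠ 0} := isOpen_ne
  have hOn : ContinuousOn (homogExt g) {y : Euc m | y ≠ 0} := by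
    rw [continuousOn_iff_continuous_domRestrict]
    have h : Set.domRestrict {y : Euc m | y ≠ 0} (homogExt g) =
        fun y : {y : Euc m | y ≠ 0} => ‖(y : Euc m)‖ * g (radialProj (y : Euc m) y.2) := by
      funext y
      exact homogExt_of_ne g y.2
    rw [h]
    refine continuous_subtype_val.norm.mul (hg.comp ?_)
    refine Continuous.subtype_mk ?_ _
    exact (continuous_subtype_val.norm.inv₀ fun y => norm_ne_zero_iff.mpr y.2).smul
      continuous_subtype_val
  exact hOn.continuousAt (hopen.mem_nhds hx)

theorem geodesic_zero {m : ℕ} (σ : Sph m) (v : tangentSphere σ) : geodesic σ v 0 = σ := by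
  apply Subtype.ext
  simp [geodesic]

theorem contMDiff_geodesic {m : ℕ} (σ : Sph m) (v : tangentSphere σ) :
    ContMDiff 𝓘(ℝ, ℝ) (𝓡 m) 2 (geodesic σ v) := by
  have : Fact (Module.finrank ℝ (Euc m) = m + 1) := ⟨finrank_euclideanSpace_fin⟩
  refine ContMDiff.codRestrict_sphere (n := m) ?_ _
  rw [contMDiff_iff_contDiff]
  fun_prop

theorem eventually_geodesic {m : ℕ} {σ : Sph m} (v : tangentSphere σ) {p : Sph m → Prop}
    (hp : ∀ᶠ y in 𝓝 σ, p y) : ∀ᶠ t in 𝓝 (0 : ℝ), p (geodesic σ v t) := by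
  have h : Tendsto (geodesic σ v) (𝓝 0) (𝓝 σ) := by
    simpa [geodesic_zero] using (contMDiff_geodesic σ v).continuous.tendsto 0
  exact h.eventually hp

theorem IsTestFunctionAt.contDiffAt_comp_geodesic {m : ℕ} {g φ : Sph m → ℝ} {σ : Sph m}
    (h : IsTestFunctionAt g φ σ) (v : tangentSphere σ) :
    ContDiffAt ℝ 2 (fun t => φ (geodesic σ v t)) 0 := by
  rw [← contMDiffAt_iff_contDiffAt]
  have h1 : ContMDiffAt (𝓡 m) 𝓘(ℝ, ℝ) 2 φ (geodesic σ v 0) := by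
    rw [geodesic_zero]; exact h.1
  exact h1.comp 0 (contMDiff_geodesic σ v).contMDiffAt

/-! ### Convexity implies the viscosity inequality. -/

/-- Otherwise the second derivative test makes `x` also a local maximum, so `f` is locally constant.
-/
theorem deriv_deriv_nonneg_of_isLocalMin {f : ℝ → ℝ} {x : ℝ} (h : IsLocalMin f x)
    (hc : ContinuousAt f x) : 0 ≤ deriv (deriv f) x := by
  by_contra! hneg
  have hmax : IsLocalMax f x := isLocalMax_of_deriv_deriv_neg hneg h.deriv_eq_zero hc
  have heq : f =ᶠ[𝓝 x] fun _ => f x := by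
    filter_upwards [h, hmax] with y h1 h2
    exact le_antisymm h2 h1
  have h2 : deriv (deriv f) x = 0 := by
    rw [heq.deriv.deriv_eq]
    simp
  exact hneg.ne h2

theorem iteratedDeriv_two_nonneg_of_symm_diff {f : ℝ → ℝ} (hf : ContDiffAt ℝ 2 f 0)
    (h : ∀ᶠ t in 𝓝 (0 : ℝ), 2 * f 0 ≤ f t + f (-t)) : 0 ≤ iteratedDeriv 2 f 0 := by
  have hf' : ContDiffAt ℝ 2 (fun t => f (-t)) 0 := by
    have : ContDiffAt ℝ 2 f (-(0 : ℝ)) := by simpa using hf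
    exact this.comp (0 : ℝ) contDiffAt_id.neg
  have hmin : IsLocalMin (fun t => f t + f (-t)) 0 := by
    filter_upwards [h] with t ht
    simpa [two_mul] using ht
  have h2 := deriv_deriv_nonneg_of_isLocalMin hmin (hf.continuousAt.add hf'.continuousAt)
  have h3 : iteratedDeriv 2 (fun t => f t + f (-t)) 0 = 2 * iteratedDeriv 2 f 0 := by
    have := iteratedDeriv_fun_add (n := 2) (f := f) (g := fun t => f (-t)) (x := 0)
      (by exact_mod_cast hf) (by exact_mod_cast hf')
    rw [this, iteratedDeriv_comp_neg]
    simp [two_mul]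
  have h4 : iteratedDeriv 2 (fun t => f t + f (-t)) 0
      = deriv (deriv (fun t => f t + f (-t))) 0 := by
    rw [iteratedDeriv_succ, iteratedDeriv_one]
  linarith

theorem hasDerivAt_cos_mul (r t : ℝ) :
    HasDerivAt (fun t => Real.cos (t * r)) (-(r * Real.sin (t * r))) t := by
  simpa [mul_comm] using ((hasDerivAt_id t).mul_const r).cos

theorem hasDerivAt_sin_mul (r t : ℝ) :
    HasDerivAt (fun t => Real.sin (t * r)) (r * Real.cos (t * r)) t := by
  simpa [mul_comm] using ((hasDerivAt_id t).mul_const r).sin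

theorem iteratedDeriv_two_cos_mul (r c : ℝ) :
    iteratedDeriv 2 (fun t : ℝ => Real.cos (t * r) * c) 0 = -(r ^ 2 * c) := by
  rw [iteratedDeriv_succ, iteratedDeriv_one]
  have h1 : deriv (fun t : ℝ => Real.cos (t * r) * c)
      = fun t => -(r * Real.sin (t * r)) * c := by
    funext t
    exact ((hasDerivAt_cos_mul r t).mul_const c).deriv
  rw [h1]
  have h2 := ((((hasDerivAt_sin_mul r 0).const_mul r).fun_neg).mul_const c).deriv
  rw [h2, zero_mul, Real.cos_zero]
  ring

theorem hessAddIdNonnegViscosity_of_convexOn {m : ℕ} {g : Sph m → ℝ}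
    (hU : ConvexOn ℝ Set.univ (homogExt g)) : HessAddIdNonnegViscosity g := by
  intro σ φ hφ v
  set h : ℝ → ℝ := fun t => φ (geodesic σ v t) with hh
  have hC : ContDiffAt ℝ 2 h 0 := hφ.contDiffAt_comp_geodesic v
  have hcos : ContDiffAt ℝ 2 (fun t : ℝ => Real.cos (t * ‖v‖) * φ σ) 0 := by fun_prop
  have hpos : ∀ᶠ t in 𝓝 (0 : ℝ), 0 < Real.cos (t * ‖v‖) := by
    have : ContinuousAt (fun t : ℝ => Real.cos (t * ‖v‖)) 0 := by fun_prop
    exact this.eventually_const_lt (by simp)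
  have hle := eventually_geodesic v hφ.2.2
  have hle' : ∀ᶠ t in 𝓝 (0 : ℝ), g (geodesic σ v (-t)) ≤ φ (geodesic σ v (-t)) := by
    have : Tendsto (fun t : ℝ => -t) (𝓝 0) (𝓝 0) := by
      simpa using (continuous_neg (G := ℝ)).tendsto 0
    exact this.eventually hle
  have key := iteratedDeriv_two_nonneg_of_symm_diff
    (f := fun t => h t - Real.cos (t * ‖v‖) * φ σ) (hC.sub hcos) (by
    filter_upwards [hpos, hle, hle'] with t h1 h2 h3
    have hmid := hU.right (Set.mem_univ (geodesic σ v t : Euc m))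
      (Set.mem_univ (geodesic σ v (-t) : Euc m)) (by norm_num : (0 : ℝ) ≤ 1 / 2)
      (by norm_num : (0 : ℝ) ≤ 1 / 2) (by norm_num)
    have hpt : (1 / 2 : ℝ) • (geodesic σ v t : Euc m) + (1 / 2 : ℝ) • (geodesic σ v (-t) : Euc m)
        = Real.cos (t * ‖v‖) • (σ : Euc m) := by
      simp only [geodesic, neg_mul, Real.cos_neg, Real.sin_neg]
      module
    rw [hpt, homogExt_smul g h1.le, homogExt_coe, homogExt_coe, homogExt_coe, ← hφ.2.1] at hmid
    simp only [smul_eq_mul] at hmid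
    simp only [hh, geodesic_zero, zero_mul, Real.cos_zero, neg_mul, Real.cos_neg]
    linarith)
  rw [iteratedDeriv_fun_sub (by exact_mod_cast hC) (by exact_mod_cast hcos),
    iteratedDeriv_two_cos_mul] at key
  simp only [hess]
  linarith

/-! ### Test functions strictly concave in one direction. -/

theorem iteratedDeriv_two_radial {r : ℝ} (hr : r ≠ 0) (y A B κ : ℝ) :
    iteratedDeriv 2 (fun t : ℝ =>
      (Real.cos (t * r) - Real.sin (t * r) / r * y) * A + Real.sin (t * r) / r * B
        - κ * ((Real.sin (t * r) / r) ^ 2 / (Real.cos (t * r) - Real.sin (t * r) / r * y))) 0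
      = -(r ^ 2 * A) - 2 * κ := by
  set s : ℝ → ℝ := fun t => Real.sin (t * r) / r with hs
  set l : ℝ → ℝ := fun t => Real.cos (t * r) - s t * y with hl
  have ds : ∀ t, HasDerivAt s (Real.cos (t * r)) t := fun t => by
    simpa only [mul_div_cancel_left₀ _ hr] using (hasDerivAt_sin_mul r t).div_const r
  have dl : ∀ t, HasDerivAt l (-(r * Real.sin (t * r)) - Real.cos (t * r) * y) t := fun t =>
    (hasDerivAt_cos_mul r t).fun_sub ((ds t).mul_const y)
  have s0 : s 0 = 0 := by simp [hs]
  have l0 : l 0 = 1 := by simp [hl, s0]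
  have hne : ∀ᶠ t in 𝓝 (0 : ℝ), l t ≠ 0 :=
    (dl 0).continuousAt.eventually_ne (by simp [l0])
  rw [iteratedDeriv_succ, iteratedDeriv_one]
  have h1 : deriv (fun t => l t * A + s t * B - κ * (s t ^ 2 / l t)) =ᶠ[𝓝 0]
      fun t => (-(r * Real.sin (t * r)) - Real.cos (t * r) * y) * A + Real.cos (t * r) * B
        - κ * ((2 * (s t * Real.cos (t * r)) * l t
          - s t ^ 2 * (-(r * Real.sin (t * r)) - Real.cos (t * r) * y)) / l t ^ 2) := by
    filter_upwards [hne] with t ht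
    refine HasDerivAt.deriv ?_
    have := (((dl t).mul_const A).fun_add ((ds t).mul_const B)).fun_sub
      ((((ds t).fun_pow 2).fun_div (dl t) ht).const_mul κ)
    convert this using 1
    push_cast
    ring
  rw [h1.deriv_eq]
  refine HasDerivAt.deriv ?_
  have dl' := ((hasDerivAt_sin_mul r 0).const_mul r).fun_neg.fun_sub
    ((hasDerivAt_cos_mul r 0).mul_const y)
  have dn := ((((ds 0).fun_mul (hasDerivAt_cos_mul r 0)).const_mul 2).fun_mul (dl 0)).fun_sub
    (((ds 0).fun_pow 2).fun_mul dl')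
  have hl2 : l 0 ^ 2 ≠ 0 := by simp [l0]
  have := ((dl'.mul_const A).fun_add ((hasDerivAt_cos_mul r 0).mul_const B)).fun_sub
    ((dn.fun_div ((dl 0).fun_pow 2) hl2).const_mul κ)
  convert this using 1
  simp [s0, l0]
  ring

/-- The quotient of a quadratic form by a linear form, plus a linear form: a function homogeneous
of degree one that is concave in the direction `e` if `Y e ≠ 0`, `X e = 0`, `Z e = 0`. -/
noncomputable def barrier {m : ℕ} (l X Y : Euc m →L[ℝ] ℝ) (Z : Euc m →L[ℝ] Euc m) (ε K : ℝ)
    (x : Euc m) : ℝ :=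
  l x + (-(ε * Y x ^ 2) + K * ‖Z x‖ ^ 2) / X x

theorem contMDiffAt_barrier {m : ℕ} (l X Y : Euc m →L[ℝ] ℝ) (Z : Euc m →L[ℝ] Euc m) (ε K : ℝ)
    {σ : Sph m} (hX : 0 < X σ) :
    ContMDiffAt (𝓡 m) 𝓘(ℝ, ℝ) 2 (fun τ : Sph m => barrier l X Y Z ε K τ) σ := by
  have : Fact (Module.finrank ℝ (Euc m) = m + 1) := ⟨finrank_euclideanSpace_fin⟩
  have h : ContDiffAt ℝ 2 (barrier l X Y Z ε K) (σ : Euc m) := by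
    unfold barrier
    refine l.contDiff.contDiffAt.add (ContDiffAt.div ?_ X.contDiff.contDiffAt hX.ne')
    exact ((contDiffAt_const.mul (Y.contDiff.contDiffAt.pow 2)).neg).add
      (contDiffAt_const.mul (Z.contDiff.contDiffAt.norm_sq ℝ))
  exact h.contMDiffAt.comp σ (contMDiff_coe_sphere (n := m)).contMDiffAt

/-- For a function homogeneous of degree one, the form `Hess + φ I` at the tangential part of `e` is
the ambient second derivative along `e`. Only `-ε Y² / X` contributes to it. -/
theorem exists_hess_barrier {m : ℕ} (l X Y : Euc m →L[ℝ] ℝ) (Z : Euc m →L[ℝ] Euc m) (ε K : ℝ)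
    {e : Euc m} (hXe : X e = 0) (hYe : Y e = 1) (hZe : Z e = 0) {σ : Sph m} (hX : 0 < X σ) :
    ∃ v : tangentSphere σ, hess (fun τ : Sph m => barrier l X Y Z ε K τ) σ v
      + barrier l X Y Z ε K σ * ‖v‖ ^ 2 = -2 * (ε / X σ) := by
  have hσ : ‖(σ : Euc m)‖ = 1 := by simp
  set c : ℝ := inner ℝ (σ : Euc m) e with hc
  have hmem : e - c • (σ : Euc m) ∈ tangentSphere σ := by
    rw [Submodule.mem_orthogonal_singleton_iff_inner_right, inner_sub_right, inner_smul_right,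
      real_inner_self_eq_norm_sq, hσ, ← hc]
    ring
  refine ⟨⟨e - c • (σ : Euc m), hmem⟩, ?_⟩
  set v : tangentSphere σ := ⟨e - c • (σ : Euc m), hmem⟩ with hv
  have hv0 : ‖v‖ ≠ 0 := by
    intro h
    have h1 : e - c • (σ : Euc m) = 0 := by
      simpa [hv] using h
    have h2 : c = 0 := by
      have := congrArg X h1
      simpa [hXe, hX.ne'] using this
    rw [h2, zero_smul, sub_zero] at h1
    simp [h1] at hYe
  set A := barrier l X Y Z ε K σ with hA
  have hgeo : (fun t : ℝ => barrier l X Y Z ε K (geodesic σ v t)) =ᶠ[𝓝 0] fun t =>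
      (Real.cos (t * ‖v‖) - Real.sin (t * ‖v‖) / ‖v‖ * c) * A
        + Real.sin (t * ‖v‖) / ‖v‖ * (l e - 2 * ε * Y σ / X σ)
        - ε / X σ * ((Real.sin (t * ‖v‖) / ‖v‖) ^ 2
          / (Real.cos (t * ‖v‖) - Real.sin (t * ‖v‖) / ‖v‖ * c)) := by
    have hne : ∀ᶠ t in 𝓝 (0 : ℝ), Real.cos (t * ‖v‖) - Real.sin (t * ‖v‖) / ‖v‖ * c ≠ 0 := by
      have : ContinuousAt (fun t : ℝ =>
        Real.cos (t * ‖v‖) - Real.sin (t * ‖v‖) / ‖v‖ * c) 0 := by fun_prop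
      exact this.eventually_ne (by simp)
    filter_upwards [hne] with t ht
    set s := Real.sin (t * ‖v‖) / ‖v‖ with hs
    set k := Real.cos (t * ‖v‖) - s * c with hk
    have hpt : (geodesic σ v t : Euc m) = k • (σ : Euc m) + s • e := by
      simp only [geodesic, hk, hs, hv]
      module
    rw [hpt, hA]
    simp only [barrier, map_add, map_smul, hXe, hYe, hZe, smul_zero, add_zero, smul_eq_mul,
      norm_smul, mul_pow, Real.norm_eq_abs, sq_abs, mul_one]
    have := hX.ne'
    field_simp
    ring
  have h2 : hess (fun τ : Sph m => barrier l X Y Z ε K τ) σ v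
      = -(‖v‖ ^ 2 * A) - 2 * (ε / X σ) := by
    rw [hess, hgeo.iteratedDeriv_eq, iteratedDeriv_two_radial hv0]
  rw [h2]
  ring

/-- A continuous function on the affine hyperplane `X = 1` that vanishes at `p` and `p + e` and is
positive at some point between them is touched from above by a quadratic polynomial that is
strictly concave in the direction `e`. -/
theorem exists_quadratic_touching {m : ℕ} {X Y : Euc m →L[ℝ] ℝ} {Z : Euc m →L[ℝ] Euc m}
    {p e : Euc m} (hdec : ∀ w, w = X w • p + Y w • e + Z w)
    (hXp : X p = 1) (hXe : X e = 0) (hYp : Y p = 0) (hYe : Y e = 1) (hZp : Z p = 0) (hZe : Z e = 0)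
    {u : Euc m → ℝ} (hu : ∀ w, X w = 1 → ContinuousAt u w) (hp : u p = 0) (hq : u (p + e) = 0)
    {s : ℝ} (hs0 : 0 ≤ s) (hs1 : s ≤ 1) (hpos : 0 < u (p + s • e)) :
    ∃ w₀ : Euc m, ∃ ε M K : ℝ, 0 < ε ∧ X w₀ = 1 ∧
      u w₀ = M + ε * Y w₀ - ε * Y w₀ ^ 2 + K * ‖Z w₀‖ ^ 2 ∧
      ∀ᶠ w in 𝓝 w₀, X w = 1 → u w ≤ M + ε * Y w - ε * Y w ^ 2 + K * ‖Z w‖ ^ 2 := by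
  set δ := u (p + s • e) with hδ
  have near : ∀ z, X z = 1 → u z = 0 → ∃ η > 0, ∀ w, ‖w - z‖ < η → u w < δ / 2 := by
    intro z hz hz0
    have := (hu z hz).eventually_lt_const (show u z < δ / 2 by rw [hz0]; linarith)
    obtain ⟨η, hη, h⟩ := Metric.eventually_nhds_iff.mp this
    exact ⟨η, hη, fun w hw => h (by rwa [dist_eq_norm])⟩
  obtain ⟨η₁, hη₁, h₁⟩ := near p hXp hp
  obtain ⟨η₂, hη₂, h₂⟩ := near (p + e) (by simp [hXp, hXe]) hq
  -- The tube of radius `η` is so thin that `u < δ / 2` on both end faces.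
  obtain ⟨η, hη, hη1, hη2⟩ : ∃ η : ℝ, 0 < η ∧ η < η₁ ∧ η < η₂ :=
    ⟨min η₁ η₂ / 2, by positivity, by have := min_le_left η₁ η₂; linarith,
      by have := min_le_right η₁ η₂; linarith⟩
  set D : Set (Euc m) := {w | X w = 1 ∧ 0 ≤ Y w ∧ Y w ≤ 1 ∧ ‖Z w‖ ≤ η} with hD
  have hDclosed : IsClosed D :=
    (isClosed_eq X.continuous continuous_const).inter
      ((isClosed_le continuous_const Y.continuous).inter
        ((isClosed_le Y.continuous continuous_const).inter
          (isClosed_le Z.continuous.norm continuous_const)))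
  have hDcompact : IsCompact D := by
    refine Metric.isCompact_of_isClosed_isBounded hDclosed ?_
    refine (Metric.isBounded_closedBall (x := (0 : Euc m)) (r := ‖p‖ + ‖e‖ + η)).subset ?_
    rintro w ⟨hw1, hw2, hw3, hw4⟩
    rw [mem_closedBall_zero_iff, hdec w, hw1, one_smul]
    have : ‖Y w • e‖ ≤ ‖e‖ := by
      rw [norm_smul, Real.norm_eq_abs, abs_of_nonneg hw2]
      exact mul_le_of_le_one_left (norm_nonneg e) hw3
    linarith [norm_add_le (p + Y w • e) (Z w), norm_add_le p (Y w • e)]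
  have huD : ContinuousOn u D := fun w hw => (hu w hw.1).continuousWithinAt
  have hmD : p + s • e ∈ D := by
    simp [hD, hXp, hXe, hYp, hYe, hZp, hZe, hs0, hs1, hη.le]
  obtain ⟨b, hbD, hb⟩ := hDcompact.exists_isMaxOn ⟨_, hmD⟩ huD
  -- With this `K` the penalty on the lateral face equals `max u`, so `F ≤ 0` there.
  set K : ℝ := u b / η ^ 2 with hK
  have hub : 0 < u b := hpos.trans_le (hb hmD)
  have hK0 : 0 < K := by positivity
  set F : Euc m → ℝ := fun w => u w - (δ * Y w - δ * Y w ^ 2 + K * ‖Z w‖ ^ 2) with hF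
  have hFD : ContinuousOn F D := huD.sub (by fun_prop)
  obtain ⟨w₀, hw₀, hmax⟩ := hDcompact.exists_isMaxOn ⟨_, hmD⟩ hFD
  -- Since `s - s² ≤ 1/4`, `F` is at least `3δ/4` at `p + s • e`; hence its maximum avoids every
  -- face of the tube.
  have hFw₀ : δ / 2 < F w₀ := by
    refine lt_of_lt_of_le ?_ (hmax hmD)
    simp only [hF, map_add, map_smul, hYp, hYe, hZp, hZe, ← hδ, smul_eq_mul, smul_zero, norm_zero,
      zero_add]
    nlinarith [mul_nonneg hpos.le (sq_nonneg (2 * s - 1))]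
  obtain ⟨hw1, hw2, hw3, hw4⟩ := hw₀
  have hZ0 : 0 ≤ K * ‖Z w₀‖ ^ 2 := by positivity
  have hY0 : 0 < Y w₀ := by
    refine hw2.lt_of_ne fun h => ?_
    have : u w₀ < δ / 2 := by
      refine h₁ _ (lt_of_le_of_lt ?_ hη1)
      have hd := hdec w₀
      rw [hw1, ← h] at hd
      have : w₀ - p = Z w₀ := by nth_rw 1 [hd]; module
      rwa [this]
    simp only [hF, ← h] at hFw₀
    linarith
  have hY1 : Y w₀ < 1 := by
    refine hw3.lt_of_ne fun h => ?_
    have : u w₀ < δ / 2 := by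
      refine h₂ _ (lt_of_le_of_lt ?_ hη2)
      have hd := hdec w₀
      rw [hw1, h] at hd
      have : w₀ - (p + e) = Z w₀ := by nth_rw 1 [hd]; module
      rwa [this]
    simp only [hF, h] at hFw₀
    linarith
  have hZ1 : ‖Z w₀‖ < η := by
    refine hw4.lt_of_ne fun h => ?_
    have h3 : u w₀ ≤ u b := hb ⟨hw1, hw2, hw3, hw4⟩
    have h4 : K * ‖Z w₀‖ ^ 2 = u b := by
      rw [h, hK]; field_simp
    have h5 : 0 ≤ δ * Y w₀ - δ * Y w₀ ^ 2 := by
      nlinarith [mul_nonneg (mul_nonneg hpos.le hw2) (sub_nonneg.mpr hw3)]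
    simp only [hF] at hFw₀
    linarith
  refine ⟨w₀, δ, F w₀, K, hpos, hw1, by simp only [hF]; ring, ?_⟩
  filter_upwards [Y.continuous.continuousAt.eventually_const_lt hY0,
    Y.continuous.continuousAt.eventually_lt_const hY1,
    Z.continuous.norm.continuousAt.eventually_lt_const hZ1] with w k1 k2 k3 k4
  have h6 : F w ≤ F w₀ := hmax ⟨k4, k1.le, k2.le, k3.le⟩
  have h7 : F w = u w - (δ * Y w - δ * Y w ^ 2 + K * ‖Z w‖ ^ 2) := rfl
  linarith

/-! ### The viscosity inequality implies convexity. -/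

theorem HessAddIdNonnegViscosity.convex_slice {m : ℕ} {g : Sph m → ℝ}
    (hv : HessAddIdNonnegViscosity g) (hg : Continuous g) {X : Euc m →L[ℝ] ℝ} {p q : Euc m}
    (hXp : X p = 1) (hXq : X q = 1) {s : ℝ} (hs0 : 0 ≤ s) (hs1 : s ≤ 1) :
    homogExt g (p + s • (q - p)) ≤ (1 - s) * homogExt g p + s * homogExt g q := by
  by_contra! hlt
  set U := homogExt g with hU
  set e := q - p with he
  have he0 : e ≠ 0 := by
    intro h
    have hqp : q = p := sub_eq_zero.mp h
    rw [h, hqp, smul_zero, add_zero] at hlt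
    linarith
  have hXe : X e = 0 := by simp [he, hXp, hXq]
  have hen : ‖e‖ ≠ 0 := norm_ne_zero_iff.mpr he0
  set Y : Euc m →L[ℝ] ℝ :=
    (‖e‖ ^ 2)⁻¹ • (innerSL ℝ e - (inner ℝ e p) • X) with hY
  have hYe : Y e = 1 := by
    simp [hY, hXe, hen]
  have hYp : Y p = 0 := by simp [hY, hXp]
  set Z : Euc m →L[ℝ] Euc m :=
    ContinuousLinearMap.id ℝ (Euc m) - X.smulRight p - Y.smulRight e with hZ
  have hdec : ∀ w, w = X w • p + Y w • e + Z w := by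
    intro w
    simp only [hZ, _root_.sub_apply, ContinuousLinearMap.smulRight_apply,
      ContinuousLinearMap.id_apply]
    module
  have hZe : Z e = 0 := by simp [hZ, hXe, hYe]
  have hZp : Z p = 0 := by simp [hZ, hXp, hYp]
  set l : Euc m →L[ℝ] ℝ := U p • X + (U q - U p) • Y with hl
  have hpe : p + e = q := by simp [he]
  have hYq : Y q = 1 := by rw [← hpe, map_add, hYp, hYe, zero_add]
  obtain ⟨w₀, ε, M, K, hε, hw₀, heq, hle⟩ := exists_quadratic_touching (u := fun w => U w - l w)
    hdec hXp hXe hYp hYe hZp hZe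
    (fun w hw => (continuousAt_homogExt hg (by rintro rfl; simp at hw)).sub
      l.continuous.continuousAt)
    (by simp [hl, hXp, hYp]) (by simp [hpe, hl, hXq, hYq]) hs0 hs1
    (by simp [hl, hXp, hXe, hYp, hYe]; linarith)
  have hw₀0 : w₀ ≠ 0 := by rintro rfl; simp at hw₀
  set σ := radialProj w₀ hw₀0 with hσ
  have hXσ : X σ = ‖w₀‖⁻¹ := by simp [hσ, radialProj, hw₀]
  have hXpos : 0 < X σ := by rw [hXσ]; exact inv_pos.mpr (norm_pos_iff.mpr hw₀0)
  -- Homogenizing by `X` turns the constant and linear terms of the touching quadratic into `L`.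
  set L : Euc m →L[ℝ] ℝ := l + M • X + ε • Y with hL
  have hscale : ∀ τ : Sph m, 0 < X τ → g τ = X τ * U ((X τ)⁻¹ • (τ : Euc m)) := by
    intro τ hτ
    rw [hU, homogExt_smul g (inv_pos.mpr hτ).le, homogExt_coe]
    field_simp
  have hbar : ∀ τ : Sph m, 0 < X τ → barrier L X Y Z ε K τ
      = X τ * (l ((X τ)⁻¹ • (τ : Euc m)) + (M + ε * Y ((X τ)⁻¹ • (τ : Euc m))
        - ε * Y ((X τ)⁻¹ • (τ : Euc m)) ^ 2 + K * ‖Z ((X τ)⁻¹ • (τ : Euc m))‖ ^ 2)) := by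
    intro τ hτ
    simp only [barrier, hL, map_smul, _root_.add_apply,
      _root_.smul_apply, smul_eq_mul, norm_smul, mul_pow, Real.norm_eq_abs, sq_abs]
    field_simp
    ring
  have hσw : (X σ)⁻¹ • (σ : Euc m) = w₀ := by
    rw [hXσ, inv_inv, hσ, radialProj, smul_smul, mul_inv_cancel₀ (norm_ne_zero_iff.mpr hw₀0),
      one_smul]
  have htest : IsTestFunctionAt g (fun τ : Sph m => barrier L X Y Z ε K τ) σ := by
    refine ⟨contMDiffAt_barrier L X Y Z ε K hXpos, ?_, ?_⟩
    · simp only [hbar σ hXpos, hscale σ hXpos, hσw]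
      rw [← heq]
      ring
    · have hXc : ContinuousAt (fun τ : Sph m => X τ) σ := by fun_prop
      have hc : Tendsto (fun τ : Sph m => (X τ)⁻¹ • (τ : Euc m)) (𝓝 σ) (𝓝 w₀) := by
        have : ContinuousAt (fun τ : Sph m => (X τ)⁻¹ • (τ : Euc m)) σ :=
          (hXc.inv₀ hXpos.ne').smul continuous_subtype_val.continuousAt
        rw [← hσw]
        exact this
      filter_upwards [hXc.eventually_const_lt hXpos, hc.eventually hle] with τ h1 h2
      have h3 := h2 (by rw [map_smul, smul_eq_mul, inv_mul_cancel₀ h1.ne'])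
      rw [hbar τ h1, hscale τ h1]
      exact mul_le_mul_of_nonneg_left (by linarith) h1.le
  obtain ⟨v, hhess⟩ := exists_hess_barrier L X Y Z ε K hXe hYe hZe hXpos
  have h4 := hv σ _ htest v
  rw [hhess] at h4
  have : 0 < ε / X σ := div_pos hε hXpos
  linarith

theorem HessAddIdNonnegViscosity.homogExt_add_le_of_pos {m : ℕ} {g : Sph m → ℝ}
    (hv : HessAddIdNonnegViscosity g) (hg : Continuous g) {X : Euc m →L[ℝ] ℝ} {x y : Euc m}
    (hx : 0 < X x) (hy : 0 < X y) :
    homogExt g (x + y) ≤ homogExt g x + homogExt g y := by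
  have hS : 0 < X x + X y := add_pos hx hy
  have h := hv.convex_slice hg (X := X) (p := (X x)⁻¹ • x) (q := (X y)⁻¹ • y)
    (by simp [hx.ne']) (by simp [hy.ne'])
    (div_pos hy hS).le ((div_le_one hS).mpr (by linarith))
  have hpt : x + y = (X x + X y) • ((X x)⁻¹ • x
      + (X y / (X x + X y)) • ((X y)⁻¹ • y - (X x)⁻¹ • x)) := by
    match_scalars <;> field_simp
    ring
  rw [hpt, homogExt_smul g hS.le]
  refine (mul_le_mul_of_nonneg_left h hS.le).trans_eq ?_
  rw [homogExt_smul g (inv_pos.mpr hx).le, homogExt_smul g (inv_pos.mpr hy).le]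
  field_simp
  ring

theorem homogExt_add_le_of_antipodal {m : ℕ} {g : Sph m → ℝ} (hg0 : ∀ σ, 0 ≤ g σ)
    {x y : Euc m} {r : ℝ} (hr : 0 ≤ r) (hy : y = -(r • x)) :
    homogExt g (x + y) ≤ homogExt g x + homogExt g y := by
  have h1 := homogExt_nonneg hg0 x
  rcases le_total r 1 with h | h
  · have hpt : x + y = (1 - r) • x := by rw [hy]; module
    rw [hpt, homogExt_smul g (by linarith)]
    nlinarith [homogExt_nonneg hg0 y]
  · have hpt : x + y = (r - 1) • (-x) := by rw [hy]; module
    have hy' : y = r • (-x) := by rw [hy, smul_neg]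
    rw [hpt, hy', homogExt_smul g (by linarith), homogExt_smul g hr]
    nlinarith [homogExt_nonneg hg0 (-x)]

theorem HessAddIdNonnegViscosity.homogExt_add_le {m : ℕ} {g : Sph m → ℝ}
    (hv : HessAddIdNonnegViscosity g) (hg : Continuous g) (hg0 : ∀ σ, 0 ≤ g σ) (x y : Euc m) :
    homogExt g (x + y) ≤ homogExt g x + homogExt g y := by
  by_cases hx : x = 0
  · simp [hx, homogExt_zero]
  have hxn : 0 < ‖x‖ := norm_pos_iff.mpr hx
  by_cases hanti : y = -((‖y‖ / ‖x‖) • x)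
  · exact homogExt_add_le_of_antipodal hg0 (by positivity) hanti
  have hy : y ≠ 0 := by
    rintro rfl
    simp at hanti
  have hyn : 0 < ‖y‖ := norm_pos_iff.mpr hy
  have hlt : -(‖x‖ * ‖y‖) < inner ℝ x y := by
    refine lt_of_le_of_ne (neg_le_of_abs_le (abs_real_inner_le_norm x y)) fun h => hanti ?_
    have h1 : inner ℝ x (-y) = ‖x‖ * ‖-y‖ := by
      rw [inner_neg_right, norm_neg, ← h, neg_neg]
    rw [inner_eq_norm_mul_iff_real, norm_neg] at h1
    rw [div_eq_inv_mul, mul_smul, h1, smul_smul, inv_mul_cancel₀ hxn.ne', one_smul, neg_neg]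
  -- The bisector of `x` and `y` has positive inner product with both.
  refine hv.homogExt_add_le_of_pos hg (X := innerSL ℝ (‖y‖ • x + ‖x‖ • y)) ?_ ?_
  · rw [innerSL_apply_apply, inner_add_left, inner_smul_left, inner_smul_left,
      real_inner_self_eq_norm_sq, real_inner_comm]
    simp only [conj_trivial]
    nlinarith
  · rw [innerSL_apply_apply, inner_add_left, inner_smul_left, inner_smul_left,
      real_inner_self_eq_norm_sq]
    simp only [conj_trivial]
    nlinarith

theorem HessAddIdNonnegViscosity.convexOn {m : ℕ} {g : Sph m → ℝ}
    (hv : HessAddIdNonnegViscosity g) (hg : Continuous g) (hg0 : ∀ σ, 0 ≤ g σ) :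
    ConvexOn ℝ Set.univ (homogExt g) := by
  refine ⟨convex_univ, fun x _ y _ a b ha hb _ => ?_⟩
  refine (hv.homogExt_add_le hg hg0 (a • x) (b • y)).trans_eq ?_
  rw [homogExt_smul g ha, homogExt_smul g hb, smul_eq_mul, smul_eq_mul]

end HomogConvex

theorem proposition5p1 (m : ℕ) (g : HomogConvex.Sph m → ℝ) (hg : Continuous g)
    (hg0 : ∀ σ, 0 ≤ g σ) :
    ConvexOn ℝ Set.univ (HomogConvex.homogExt g) ↔ HomogConvex.HessAddIdNonnegViscosity g :=
  ⟨HomogConvex.hessAddIdNonnegViscosity_of_convexOn, fun hv => hv.convexOn hg hg0⟩
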